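/- A ribbon graph $G$ is a (possibly non-orientable) surface with boundary, glued from a finite set of closed discs (the vertices) and a finite set $\mathcal N$ of rectangles (the edges, or ribbons), each rectangle being attached to the boundary circles of the vertices along two opposite sides (its ends), all these ends being pairwise disjoint; ribbon graphs are considered up to homeomorphisms respecting this decomposition. For $J\subset\mathcal N$ the partial dual $\mu_J(G)$ is obtained as follows: from the union of the boundary circles of the vertices remove, for every ribbon in $J$, its two ends, and add the two other sides of this ribbon; the result is again a disjoint union of circles; attach to each of these circles a new disc (these are the vertices of $\mu_J(G)$), and glue back the same ribbons. If $G$ has one vertex, it is the same thing as a framed chord diagram: the circle is the boundary of the vertex, each ribbon is a chord joining the positions of its two ends, and the framing says whether the ribbon is untwisted or twisted (forms an annulus or a Möbius band with the vertex). Its intersection matrix $M=(a_{ij})_{i,j\in\mathcal N}$ over $\mathbb F_2$ has $a_{ii}=1$ if the ribbon $i$ is twisted and $a_{ii}=0$ otherwise, and, for $i\ne j$, $a_{ij}=1$ if the chords $i$ and $j$ intersect (their ends alternate on the circle) and $a_{ij}=0$ otherwise. **Proposition.** Let $G$ be a one-vertex ribbon graph with set of ribbons $\mathcal N$, let $M$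 be its intersection matrix, and let $J\subset\mathcal N$. Then $\mu_J(G)$ has exactly one vertex if and only if the principal minor $\det H$, $H=(a_{ij})_{i,j\in J}$, is non-zero in $\mathbb F_2$ (where the determinant of the empty matrix is $1$). -/

import Mathlib

/-- A ribbon graph with set of edges (ribbons) `E`, given by how the ribbons are glued to the
vertex discs. `C` is the set of corners of the ribbons; each ribbon is a rectangle, attached to
the vertices along two opposite segments (its ends); the other two segments are its sides.
* `endArc c` is the other corner of the end of the ribbon on which `c` lies,
* `sideArc c` is the other corner of the side of the ribbon on which `c` lies,
* `vertexArc c` is the corner reached from `c` by following the boundary of the vertex disc away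
  from the ribbon of `c`, up to the next end of a ribbon.
`isolated` counts the vertex discs to which no ribbon is attached. There is no restriction on
orientability, connectedness or the number of vertices. -/
@[ext]
structure RibbonGraph (E C : Type*) where
  edge : C → E
  endArc : C → C
  sideArc : C → C
  vertexArc : C → C
  isolated : ℕ
  endArc_endArc : ∀ c, endArc (endArc c) = c
  sideArc_sideArc : ∀ c, sideArc (sideArc c) = c
  vertexArc_vertexArc : ∀ c, vertexArc (vertexArc c) = c
  endArc_ne : ∀ c, endArc c ≠ c
  sideArc_ne : ∀ c, sideArc c ≠ c
  vertexArc_ne : ∀ c, vertexArc c ≠ c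
  endArc_sideArc : ∀ c, endArc (sideArc c) = sideArc (endArc c)
  endArc_sideArc_ne : ∀ c, endArc (sideArc c) ≠ c
  edge_endArc : ∀ c, edge (endArc c) = edge c
  edge_sideArc : ∀ c, edge (sideArc c) = edge c
  exists_corner : ∀ e, ∃ c, edge c = e
  corner_eq : ∀ c d, edge d = edge c →
    d = c ∨ d = endArc c ∨ d = sideArc c ∨ d = endArc (sideArc c)

namespace RibbonGraph

variable {E C : Type*}

/-- The vertices of `G`: each is either a disc whose boundary circle is a connected component of
the one-dimensional manifold formed by the ends of the ribbons and the arcs of vertex boundaries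
between them, or an isolated disc. -/
def Vertex (G : RibbonGraph E C) : Type _ :=
  Quot (fun c d : C => d = G.endArc c ∨ d = G.vertexArc c) ⊕ Fin G.isolated

/-- `G` has exactly one vertex. -/
def IsOneVertex (G : RibbonGraph E C) : Prop :=
  Nat.card G.Vertex = 1

/-- The partial dual `μ_J(G)`. The union of the vertex boundaries is replaced by its symmetric
difference with the boundaries of the ribbons in `J`; the new circles are filled by discs and the
same ribbons are glued back. So for the ribbons in `J`, and only for those, the ends become sides
and the sides become ends. -/
def partialDual [DecidableEq E] (G : RibbonGraph E C) (J : Finset E) : RibbonGraph E C where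
  edge := G.edge
  endArc c := if G.edge c ∈ J then G.sideArc c else G.endArc c
  sideArc c := if G.edge c ∈ J then G.endArc c else G.sideArc c
  vertexArc := G.vertexArc
  isolated := G.isolated
  endArc_endArc c := by
    split_ifs <;> simp_all [G.edge_endArc, G.edge_sideArc, G.endArc_endArc, G.sideArc_sideArc]
  sideArc_sideArc c := by
    split_ifs <;> simp_all [G.edge_endArc, G.edge_sideArc, G.endArc_endArc, G.sideArc_sideArc]
  vertexArc_vertexArc := G.vertexArc_vertexArc
  endArc_ne c := by
    split_ifs
    exacts [G.sideArc_ne c, G.endArc_ne c]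
  sideArc_ne c := by
    split_ifs
    exacts [G.endArc_ne c, G.sideArc_ne c]
  vertexArc_ne := G.vertexArc_ne
  endArc_sideArc c := by
    split_ifs <;> simp_all [G.edge_endArc, G.edge_sideArc, G.endArc_sideArc]
  endArc_sideArc_ne c := by
    have h := G.endArc_sideArc_ne c
    split_ifs <;> simp_all [G.edge_endArc, G.edge_sideArc, G.endArc_sideArc]
  edge_endArc c := by
    split_ifs
    exacts [G.edge_sideArc c, G.edge_endArc c]
  edge_sideArc c := by
    split_ifs
    exacts [G.edge_endArc c, G.edge_sideArc c]
  exists_corner := G.exists_corner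
  corner_eq c d h := by
    have h' := G.corner_eq c d h
    split_ifs <;> simp_all [G.edge_endArc, G.edge_sideArc, G.endArc_sideArc] <;> tauto

/-- Partial duality with respect to a set of edges is the composition of the partial dualities
with respect to its elements. -/
theorem partialDual_empty [DecidableEq E] (G : RibbonGraph E C) : G.partialDual ∅ = G := by
  ext <;> simp [partialDual]

theorem partialDual_insert [DecidableEq E] (G : RibbonGraph E C) (e : E) (J : Finset E)
    (he : e ∉ J) : G.partialDual (insert e J) = (G.partialDual J).partialDual {e} := by
  ext c
  · rfl
  · by_cases h : G.edge c = e <;> simp_all [partialDual]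
  · by_cases h : G.edge c = e <;> simp_all [partialDual]
  · rfl
  · rfl

/-- One step along the boundary circle of a vertex: from a corner `c` across the end of the ribbon
on which `c` lies, then along the vertex boundary to the next end of a ribbon. The corners
`c, boundaryStep c, boundaryStep (boundaryStep c), …` are the first-met corners of the successive
ribbon ends on that circle, traversed in the direction determined by `c`; one revolution
takes `Function.minimalPeriod boundaryStep c` steps. -/
def boundaryStep (G : RibbonGraph E C) (c : C) : C :=
  G.vertexArc (G.endArc c)

/-- In a one-vertex ribbon graph: the ribbons `i` and `j` are attached to the boundary circle of
the vertex in alternating order `i, j, i, j`, that is, the corresponding chords intersect. -/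
def Interlaced (G : RibbonGraph E C) (i j : E) : Prop :=
  ∃ (c : C) (k l m : ℕ), 0 < k ∧ k < l ∧ l < m ∧ m < Function.minimalPeriod G.boundaryStep c ∧
    G.edge c = i ∧ G.edge (G.boundaryStep^[k] c) = j ∧
    G.edge (G.boundaryStep^[l] c) = i ∧ G.edge (G.boundaryStep^[m] c) = j

/-- In a one-vertex ribbon graph: the ribbon `e` is twisted (disoriented), that is, it forms a
Möbius band with the vertex. When the boundary circle of the vertex is traversed in one direction,
a side of `e` joins the first-met corners of its two ends, whereas a side of an untwisted ribbon
joins the first-met corner of one end to the last-met corner of the other. -/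
def Twisted (G : RibbonGraph E C) (e : E) : Prop :=
  ∃ (c : C) (k : ℕ), G.edge c = e ∧ G.sideArc c = G.boundaryStep^[k] c

open Classical in
/-- The intersection matrix over `𝔽₂` of a one-vertex ribbon graph (a framed chord diagram). -/
noncomputable def intersectionMatrix (G : RibbonGraph E C) : Matrix E E (ZMod 2) :=
  Matrix.of fun i j =>
    if i = j then (if G.Twisted i then 1 else 0) else (if G.Interlaced i j then 1 else 0)

end RibbonGraph

namespace RibbonGraph

variable {E C : Type*} (G : RibbonGraph E C)

/-! Connectedness is tested by `ZMod 2`-valued functions on corners: once isolated discs are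
excluded, there is one vertex iff every function constant along ends and vertex arcs is constant.

Consider functions `f` constant along vertex arcs that jump by `x e` across both ends of each ribbon
`e`. On a one-vertex `G` every `x` occurs (`IsOneVertex.exists_jump`), since one revolution meets
each ribbon twice. Following the circle from one end of `e` to the other crosses exactly the
interlaced ribbons an odd number of times, so `f` jumps by `(M x) e` along the sides of `e`
(`IsOneVertex.apply_sideArc`), the diagonal entry recording the twist.

In the partial dual, sides replace ends for ribbons in `J`. So `f` is constant along the new
boundaries iff `x` vanishes off `J` and `M x` vanishes on `J`, i.e. `x` restricts to a kernel vector
of `H`; and `f` is constant iff `x = 0`. Hence there is one vertex iff `H` has trivial kernel. -/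

theorem finite_corners {E C : Type*} [Finite E] (G : RibbonGraph E C) : Finite C := by
  choose r hr using G.exists_corner
  refine Finite.of_surjective (α := E × Bool × Bool)
    (fun p => (if p.2.1 then G.endArc else id) ((if p.2.2 then G.sideArc else id) (r p.1))) ?_
  intro c
  rcases G.corner_eq (r (G.edge c)) c (hr _).symm with h | h | h | h
  · exact ⟨(G.edge c, false, false), by simpa using h.symm⟩
  · exact ⟨(G.edge c, true, false), by simpa using h.symm⟩
  · exact ⟨(G.edge c, false, true), by simpa using h.symm⟩
  · exact ⟨(G.edge c, true, true), by simpa using h.symm⟩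

/-! ### Vertices detected by test functions -/

/-- A ribbon graph with at least one ribbon has exactly one vertex iff it has no isolated vertex
and every function on corners that is constant along the vertex boundaries is constant. -/
theorem isOneVertex_iff (c₀ : C) : G.IsOneVertex ↔ G.isolated = 0 ∧
    ∀ f : C → ZMod 2, (∀ c, f (G.endArc c) = f c) → (∀ c, f (G.vertexArc c) = f c) →
      ∀ c d, f c = f d := by
  classical
  unfold IsOneVertex
  rw [Nat.card_eq_one_iff_unique]
  constructor
  · rintro ⟨hs, -⟩
    refine ⟨?_, fun f ha hv c d => ?_⟩
    · by_contra h
      have := hs.elim (Sum.inl (Quot.mk _ c₀)) (Sum.inr ⟨0, Nat.pos_of_ne_zero h⟩)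
      simp at this
    · have h := Sum.inl_injective (hs.elim (Sum.inl (Quot.mk _ c)) (Sum.inl (Quot.mk _ d)))
      refine congrArg (Quot.lift f ?_) h
      rintro a b (rfl | rfl)
      exacts [(ha a).symm, (hv a).symm]
  · rintro ⟨h0, h⟩
    have hq : ∀ c d : C,
        (Quot.mk (fun c d : C => d = G.endArc c ∨ d = G.vertexArc c) c) = Quot.mk _ d := by
      intro c d
      -- The test function is the indicator of the class of `c`.
      have := h (fun d => if Quot.mk (fun c d : C => d = G.endArc c ∨ d = G.vertexArc c) c =
        Quot.mk _ d then 1 else 0) (fun d => ?_) (fun d => ?_) c d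
      · by_contra hne
        simp [hne] at this
      · rw [← Quot.sound (r := fun c d : C => d = G.endArc c ∨ d = G.vertexArc c) (Or.inl rfl)]
      · rw [← Quot.sound (r := fun c d : C => d = G.endArc c ∨ d = G.vertexArc c) (Or.inr rfl)]
    refine ⟨⟨?_⟩, ⟨Sum.inl (Quot.mk _ c₀)⟩⟩
    rintro (⟨⟨c⟩⟩ | i) (⟨⟨d⟩⟩ | j)
    · exact congrArg Sum.inl (hq c d)
    · exact absurd j.2 (by omega)
    · exact absurd i.2 (by omega)
    · exact absurd i.2 (by omega)

/-! ### Traversing a boundary circle -/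

theorem vertexArc_endArc_ne (c : C) : G.boundaryStep c ≠ G.endArc c :=
  G.vertexArc_ne _

theorem boundaryStep_injective : Function.Injective G.boundaryStep := fun c d h => by
  have := congrArg (fun z => G.endArc (G.vertexArc z)) h
  simpa [boundaryStep, G.vertexArc_vertexArc, G.endArc_endArc] using this

/-- Both arcs are involutions, so `endArc` conjugates `boundaryStep` to its inverse: it reverses the
direction of travel. -/
theorem boundaryStep_endArc_boundaryStep (c : C) :
    G.boundaryStep (G.endArc (G.boundaryStep c)) = G.endArc c := by
  simp [boundaryStep, G.vertexArc_vertexArc, G.endArc_endArc]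

theorem iterate_boundaryStep_endArc (k : ℕ) (c : C) :
    G.boundaryStep^[k] (G.endArc (G.boundaryStep^[k] c)) = G.endArc c := by
  induction k generalizing c with
  | zero => rfl
  | succ k ih =>
    rw [Function.iterate_succ_apply' _ k c, Function.iterate_succ_apply,
      G.boundaryStep_endArc_boundaryStep, ih]

/-- The two directions of traversal of a vertex boundary are never mixed. -/
theorem iterate_boundaryStep_ne_endArc (k : ℕ) (c : C) :
    G.boundaryStep^[k] c ≠ G.endArc c := by
  -- Reversal cancels one step at each end of the path, reducing to a fixed point of `endArc` or of
  -- `vertexArc`.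
  induction k using Nat.twoStepInduction generalizing c with
  | zero => exact (G.endArc_ne c).symm
  | one => exact G.vertexArc_endArc_ne c
  | more k ih _ =>
    intro h
    rw [Function.iterate_succ_apply, Function.iterate_succ_apply',
      ← G.boundaryStep_endArc_boundaryStep] at h
    exact ih _ (G.boundaryStep_injective h)

theorem iterate_boundaryStep_endArc_of_le {k : ℕ} {c : C}
    (hk : k ≤ Function.minimalPeriod G.boundaryStep c) :
    G.boundaryStep^[k] (G.endArc c) =
      G.endArc (G.boundaryStep^[Function.minimalPeriod G.boundaryStep c - k] c) := by
  have h := G.iterate_boundaryStep_endArc k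
    (G.boundaryStep^[Function.minimalPeriod G.boundaryStep c - k] c)
  rw [← Function.iterate_add_apply, Nat.add_sub_cancel' hk,
    Function.iterate_minimalPeriod] at h
  exact h

theorem iterate_boundaryStep_inj {c : C} {k l : ℕ}
    (hk : k < Function.minimalPeriod G.boundaryStep c)
    (hl : l < Function.minimalPeriod G.boundaryStep c)
    (h : G.boundaryStep^[k] c = G.boundaryStep^[l] c) : k = l :=
  Function.iterate_injOn_Iio_minimalPeriod hk hl h

theorem iterate_boundaryStep_apply_eq_sum {f : C → ZMod 2} {x : E → ZMod 2}
    (hv : ∀ c, f (G.vertexArc c) = f c) (ha : ∀ c, f (G.endArc c) = f c + x (G.edge c))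
    (c : C) (k : ℕ) : f (G.boundaryStep^[k] c) =
      f c + ∑ l ∈ Finset.range k, x (G.edge (G.boundaryStep^[l] c)) := by
  induction k with
  | zero => simp
  | succ k ih =>
    rw [Function.iterate_succ_apply', boundaryStep, hv, ha, ih, Finset.sum_range_succ, add_assoc]

section Finite

variable [Finite C]

theorem minimalPeriod_boundaryStep_pos (c : C) : 0 < Function.minimalPeriod G.boundaryStep c :=
  Function.minimalPeriod_pos_of_mem_periodicPts (G.boundaryStep_injective.mem_periodicPts c)

theorem exists_iterate_boundaryStep_symm (k : ℕ) (c : C) :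
    ∃ l, G.boundaryStep^[l] (G.boundaryStep^[k] c) = c := by
  have hN := G.minimalPeriod_boundaryStep_pos c
  -- A natural number congruent to `-k` modulo the period.
  refine ⟨Function.minimalPeriod G.boundaryStep c * k - k, ?_⟩
  rw [← Function.iterate_add_apply, Nat.sub_add_cancel (Nat.le_mul_of_pos_left k hN)]
  exact (Function.isPeriodicPt_minimalPeriod G.boundaryStep c).mul_const k

theorem exists_lt_iterate_boundaryStep (k : ℕ) (c : C) :
    ∃ l < Function.minimalPeriod G.boundaryStep c,
      G.boundaryStep^[l] c = G.boundaryStep^[k] c :=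
  ⟨_, Nat.mod_lt k (G.minimalPeriod_boundaryStep_pos c), Function.iterate_mod_minimalPeriod_eq⟩

theorem iterate_boundaryStep_ne_endArc_iterate (k l : ℕ) (c : C) :
    G.boundaryStep^[k] c ≠ G.endArc (G.boundaryStep^[l] c) := by
  intro h
  obtain ⟨m, hm⟩ := G.exists_iterate_boundaryStep_symm l c
  apply G.iterate_boundaryStep_ne_endArc (k + m) (G.boundaryStep^[l] c)
  rw [Function.iterate_add_apply, hm, h]

theorem minimalPeriod_boundaryStep_iterate (k : ℕ) (c : C) :
    Function.minimalPeriod G.boundaryStep (G.boundaryStep^[k] c) =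
      Function.minimalPeriod G.boundaryStep c :=
  Function.minimalPeriod_apply_iterate (G.boundaryStep_injective.mem_periodicPts c) k

theorem minimalPeriod_boundaryStep_endArc (c : C) :
    Function.minimalPeriod G.boundaryStep (G.endArc c) =
      Function.minimalPeriod G.boundaryStep c := by
  have key : ∀ c, Function.minimalPeriod G.boundaryStep (G.endArc c) ≤
      Function.minimalPeriod G.boundaryStep c := fun c => by
    apply Function.IsPeriodicPt.minimalPeriod_le (G.minimalPeriod_boundaryStep_pos c)
    have := G.iterate_boundaryStep_endArc_of_le (c := c) le_rfl
    simpa [Function.IsPeriodicPt, Function.IsFixedPt] using this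
  refine le_antisymm (key c) ?_
  simpa [G.endArc_endArc] using key (G.endArc c)

/-- On the boundary circle of the only vertex, every corner is the first-met or the last-met
corner of a ribbon end. -/
theorem IsOneVertex.exists_iterate {G : RibbonGraph E C} (hG : G.IsOneVertex) (c d : C) :
    ∃ k, d = G.boundaryStep^[k] c ∨ d = G.endArc (G.boundaryStep^[k] c) := by
  classical
  set S : C → Prop := fun d => ∃ k, d = G.boundaryStep^[k] c ∨ d = G.endArc (G.boundaryStep^[k] c)
  have ha : ∀ d, S d → S (G.endArc d) := by
    rintro d ⟨k, rfl | rfl⟩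
    exacts [⟨k, Or.inr rfl⟩, ⟨k, Or.inl (G.endArc_endArc _)⟩]
  have hv : ∀ d, S d → S (G.vertexArc d) := by
    rintro d ⟨k, rfl | rfl⟩
    -- Period minus one steps amount to one step back.
    · refine ⟨k + (Function.minimalPeriod G.boundaryStep c - 1), Or.inr ?_⟩
      have h : G.boundaryStep^[k] c = G.boundaryStep (G.boundaryStep^[k +
          (Function.minimalPeriod G.boundaryStep c - 1)] c) := by
        rw [← Function.iterate_succ_apply' G.boundaryStep, Nat.succ_eq_add_one, add_assoc,
          Nat.sub_add_cancel (G.minimalPeriod_boundaryStep_pos c), Function.iterate_add_apply,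
          Function.iterate_minimalPeriod]
      rw [h, boundaryStep, G.vertexArc_vertexArc]
    · exact ⟨k + 1, Or.inl (by rw [Function.iterate_succ_apply']; rfl)⟩
  have ha' : ∀ d, S (G.endArc d) ↔ S d := fun d =>
    ⟨fun h => by simpa [G.endArc_endArc] using ha _ h, ha d⟩
  have hv' : ∀ d, S (G.vertexArc d) ↔ S d := fun d =>
    ⟨fun h => by simpa [G.vertexArc_vertexArc] using hv _ h, hv d⟩
  have h := ((G.isOneVertex_iff c).1 hG).2 (fun d => if S d then 1 else 0)
    (fun d => by simp only [ha']) (fun d => by simp only [hv']) c d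
  have hc : S c := ⟨0, Or.inl rfl⟩
  by_contra hd
  change ¬ S d at hd
  simp [hc, hd] at h

/-- A ribbon has at most two ends on one boundary circle. -/
theorem eq_or_eq_of_edge_eq {c : C} {k l m : ℕ}
    (hk : k < Function.minimalPeriod G.boundaryStep c)
    (hl : l < Function.minimalPeriod G.boundaryStep c)
    (hm : m < Function.minimalPeriod G.boundaryStep c) (hkl : k ≠ l)
    (h₁ : G.edge (G.boundaryStep^[l] c) = G.edge (G.boundaryStep^[k] c))
    (h₂ : G.edge (G.boundaryStep^[m] c) = G.edge (G.boundaryStep^[k] c)) : m = k ∨ m = l := by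
  have ne := G.iterate_boundaryStep_ne_endArc_iterate
  -- Each of the two ends of the ribbon has at most one first-met corner in a fixed direction.
  rcases G.corner_eq _ _ h₂ with h | h | h | h
  · exact Or.inl (G.iterate_boundaryStep_inj hm hk h)
  · exact absurd h (ne _ _ _)
  all_goals
    rcases G.corner_eq _ _ h₁ with h' | h' | h' | h'
    · exact absurd (G.iterate_boundaryStep_inj hl hk h').symm hkl
    · exact absurd h' (ne _ _ _)
  · exact Or.inr (G.iterate_boundaryStep_inj hm hl (h.trans h'.symm))
  · exact absurd (h'.trans (congrArg G.endArc h.symm)) (ne _ _ _)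
  · exact absurd (h.trans (congrArg G.endArc h'.symm)) (ne _ _ _)
  · exact Or.inr (G.iterate_boundaryStep_inj hm hl (h.trans h'.symm))

variable {G}

/-- The other end of the ribbon on which `c` lies. -/
theorem IsOneVertex.exists_other_end (hG : G.IsOneVertex) (c : C) :
    ∃ q, 0 < q ∧ q < Function.minimalPeriod G.boundaryStep c ∧
      G.edge (G.boundaryStep^[q] c) = G.edge c ∧
      (G.sideArc c = G.boundaryStep^[q] c ∨ G.sideArc c = G.endArc (G.boundaryStep^[q] c)) := by
  obtain ⟨k, hk⟩ := hG.exists_iterate c (G.sideArc c)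
  obtain ⟨q, hq, e⟩ := G.exists_lt_iterate_boundaryStep k c
  rw [← e] at hk
  refine ⟨q, Nat.pos_of_ne_zero ?_, hq, ?_, hk⟩
  · rintro rfl
    rcases hk with h | h
    · exact G.sideArc_ne c h
    · exact G.endArc_sideArc_ne c (by rw [h, G.endArc_endArc]; rfl)
  · rcases hk with h | h
    · rw [← h, G.edge_sideArc]
    · rw [← G.edge_endArc, ← h, G.edge_sideArc]

/-- Going once around the vertex, every ribbon is met an even number of times. -/
theorem IsOneVertex.sum_edge_eq_zero (hG : G.IsOneVertex) (c : C) (x : E → ZMod 2) :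
    ∑ k ∈ Finset.range (Function.minimalPeriod G.boundaryStep c),
      x (G.edge (G.boundaryStep^[k] c)) = 0 := by
  classical
  have := Fintype.ofFinite C
  set O : Finset C := (Finset.range (Function.minimalPeriod G.boundaryStep c)).image
    (fun k => G.boundaryStep^[k] c) with hO
  have memO : ∀ d, d ∈ O ↔ ∃ k, d = G.boundaryStep^[k] c := fun d => by
    simp only [hO, Finset.mem_image, Finset.mem_range]
    constructor
    · rintro ⟨k, -, rfl⟩; exact ⟨k, rfl⟩
    · rintro ⟨k, rfl⟩; exact G.exists_lt_iterate_boundaryStep k c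
  have hor : ∀ d, d ∉ O → G.endArc d ∈ O := fun d hd => by
    obtain ⟨k, h | h⟩ := hG.exists_iterate c d
    · exact absurd ((memO d).2 ⟨k, h⟩) hd
    · exact (memO _).2 ⟨k, by rw [h, G.endArc_endArc]⟩
  have hnot : ∀ d ∈ O, G.endArc d ∉ O := fun d hd hd' => by
    obtain ⟨k, rfl⟩ := (memO d).1 hd
    obtain ⟨l, hl⟩ := (memO _).1 hd'
    exact G.iterate_boundaryStep_ne_endArc_iterate l k c hl.symm
  have hsum : ∑ d ∈ O, x (G.edge d) = 0 := by
    -- `O` holds the first-met corners, one per ribbon end; the involution passes to the first-met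
    -- corner of the other end of the same ribbon.
    refine Finset.sum_involution
      (fun d _ => if G.sideArc d ∈ O then G.sideArc d else G.endArc (G.sideArc d)) ?_ ?_ ?_ ?_
    · intro d _
      have : G.edge (if G.sideArc d ∈ O then G.sideArc d else G.endArc (G.sideArc d)) =
          G.edge d := by
        split_ifs <;> simp [G.edge_endArc, G.edge_sideArc]
      rw [this, CharTwo.add_self_eq_zero]
    · intro d _ _
      split_ifs
      exacts [G.sideArc_ne d, G.endArc_sideArc_ne d]
    · intro d _
      split_ifs with h
      exacts [h, hor _ h]
    · intro d hd
      by_cases h : G.sideArc d ∈ O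
      · simp [h, G.sideArc_sideArc, hd]
      · have e : G.sideArc (G.endArc (G.sideArc d)) = G.endArc d := by
          rw [G.endArc_sideArc, G.sideArc_sideArc]
        simp only [h, if_false, e, hnot d hd, G.endArc_endArc]
  rwa [hO, Finset.sum_image] at hsum
  intro k hk l hl h
  exact G.iterate_boundaryStep_inj (by simpa using hk) (by simpa using hl) h

/-! ### Twisting, interlacing and the rows of the intersection matrix -/

/-- Whether a ribbon is twisted can be tested at any of its corners. -/
theorem twisted_iff (c : C) :
    G.Twisted (G.edge c) ↔ ∃ k, G.sideArc c = G.boundaryStep^[k] c := by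
  refine ⟨?_, fun ⟨k, h⟩ => ⟨c, k, rfl, h⟩⟩
  have hs : ∀ d, (∃ k, G.sideArc d = G.boundaryStep^[k] d) →
      ∃ k, G.sideArc (G.sideArc d) = G.boundaryStep^[k] (G.sideArc d) := by
    rintro d ⟨k, h⟩
    obtain ⟨l, hl⟩ := G.exists_iterate_boundaryStep_symm k d
    exact ⟨l, by rw [G.sideArc_sideArc, h, hl]⟩
  have ha : ∀ d, (∃ k, G.sideArc d = G.boundaryStep^[k] d) →
      ∃ k, G.sideArc (G.endArc d) = G.boundaryStep^[k] (G.endArc d) := by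
    rintro d ⟨k, h⟩
    obtain ⟨l, hl⟩ := G.exists_iterate_boundaryStep_symm k (G.endArc (G.boundaryStep^[k] d))
    rw [G.iterate_boundaryStep_endArc] at hl
    exact ⟨l, by rw [← G.endArc_sideArc, h, hl]⟩
  rintro ⟨d, k, hd, h⟩
  have hd' : ∃ k, G.sideArc d = G.boundaryStep^[k] d := ⟨k, h⟩
  rcases G.corner_eq d c hd.symm with rfl | rfl | rfl | rfl
  exacts [hd', ha _ hd', hs _ hd', ha _ (hs _ hd')]

/-- Whether two ribbons are interlaced can be tested starting from any corner of the first. -/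
theorem interlaced_iff (c : C) (j : E) :
    G.Interlaced (G.edge c) j ↔ ∃ k l m : ℕ, 0 < k ∧ k < l ∧ l < m ∧
      m < Function.minimalPeriod G.boundaryStep c ∧ G.edge (G.boundaryStep^[k] c) = j ∧
      G.edge (G.boundaryStep^[l] c) = G.edge c ∧ G.edge (G.boundaryStep^[m] c) = j := by
  set P : C → Prop := fun c => ∃ k l m : ℕ, 0 < k ∧ k < l ∧ l < m ∧
      m < Function.minimalPeriod G.boundaryStep c ∧ G.edge (G.boundaryStep^[k] c) = j ∧
      G.edge (G.boundaryStep^[l] c) = G.edge c ∧ G.edge (G.boundaryStep^[m] c) = j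
  change _ ↔ P c
  refine ⟨?_, fun ⟨k, l, m, hk, hl, hm, hN, h₁, h₂, h₃⟩ =>
    ⟨c, k, l, m, hk, hl, hm, hN, rfl, h₁, h₂, h₃⟩⟩
  have ha : ∀ d, P d → P (G.endArc d) := by
    rintro d ⟨k, l, m, hk, hl, hm, hN, h₁, h₂, h₃⟩
    -- Reversing direction sends position `p` to period minus `p`, so the order of the three
    -- positions is reversed.
    refine ⟨Function.minimalPeriod G.boundaryStep d - m,
      Function.minimalPeriod G.boundaryStep d - l,
      Function.minimalPeriod G.boundaryStep d - k, Nat.sub_pos_of_lt hN, by omega, by omega, ?_, ?_, ?_, ?_⟩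
    · rw [G.minimalPeriod_boundaryStep_endArc]; omega
    all_goals
      rw [G.iterate_boundaryStep_endArc_of_le (Nat.sub_le _ _), G.edge_endArc,
        Nat.sub_sub_self (by omega)]
    · exact h₃
    · rw [h₂, G.edge_endArc]
    · exact h₁
  have hs : ∀ d, P d → P (G.sideArc d) := by
    rintro d ⟨k, l, m, hk, hl, hm, hN, h₁, h₂, h₃⟩
    -- Restart at the other end of the first ribbon: the cyclic pattern i, j, i, j is rotated by two
    -- places.
    have hl' : P (G.boundaryStep^[l] d) := by
      refine ⟨m - l, Function.minimalPeriod G.boundaryStep d - l,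
        Function.minimalPeriod G.boundaryStep d - l + k, by omega, by omega, by omega, ?_, ?_, ?_,
        ?_⟩
      · rw [G.minimalPeriod_boundaryStep_iterate]; omega
      · rwa [← Function.iterate_add_apply, Nat.sub_add_cancel hm.le]
      · rw [← Function.iterate_add_apply, Nat.sub_add_cancel (by omega),
          Function.iterate_minimalPeriod, h₂]
      · rw [← Function.iterate_add_apply, add_right_comm, Nat.sub_add_cancel (by omega),
          add_comm, Function.iterate_add_apply, Function.iterate_minimalPeriod, h₁]
    rcases G.corner_eq _ _ h₂ with h | h | h | h
    · have := G.iterate_boundaryStep_inj (k := l) (l := 0) (by omega) (by omega) h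
      omega
    · exact absurd h (G.iterate_boundaryStep_ne_endArc _ _)
    · rwa [h] at hl'
    · rw [h] at hl'
      simpa [G.endArc_endArc] using ha _ hl'
  rintro ⟨d, k, l, m, hk, hl, hm, hN, hd, h₁, h₂, h₃⟩
  have hPd : P d := ⟨k, l, m, hk, hl, hm, hN, h₁, h₂.trans hd.symm, h₃⟩
  rcases G.corner_eq d c hd.symm with rfl | rfl | rfl | rfl
  exacts [hPd, ha _ hPd, hs _ hPd, ha _ (hs _ hPd)]

/-- Between the two ends of a ribbon, another ribbon is met an odd number of times iff the two
are interlaced. -/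
theorem IsOneVertex.sum_between_ite [DecidableEq E] (hG : G.IsOneVertex) {c : C} {q : ℕ}
    (hq₀ : 0 < q) (hq : q < Function.minimalPeriod G.boundaryStep c)
    (hqc : G.edge (G.boundaryStep^[q] c) = G.edge c) (j : E) :
    ∑ k ∈ Finset.Ico 1 q, (if G.edge (G.boundaryStep^[k] c) = j then (1 : ZMod 2) else 0) =
      if G.edge c = j then 0 else G.intersectionMatrix (G.edge c) j := by
  classical
  have only : ∀ k < Function.minimalPeriod G.boundaryStep c,
      G.edge (G.boundaryStep^[k] c) = G.edge c → k = 0 ∨ k = q := fun k hk h =>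
    G.eq_or_eq_of_edge_eq (by omega) hq hk hq₀.ne hqc h
  split_ifs with hj
  · subst hj
    refine Finset.sum_eq_zero fun k hk => if_neg fun h => ?_
    rw [Finset.mem_Ico] at hk
    rcases only k (by omega) h with h | h <;> omega
  · simp only [intersectionMatrix, Matrix.of_apply, if_neg hj]
    split_ifs with hI
    · obtain ⟨k, l, m, hk, hl, hm, hN, h₁, h₂, h₃⟩ := (interlaced_iff c j).1 hI
      have hlq : l = q := (only l (by omega) h₂).resolve_left (by omega)
      subst hlq
      rw [Finset.sum_eq_single_of_mem k (Finset.mem_Ico.2 ⟨hk, hl⟩), if_pos h₁]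
      intro k' hk' hne
      refine if_neg fun h => ?_
      rw [Finset.mem_Ico] at hk'
      rcases G.eq_or_eq_of_edge_eq (k := k) (l := m) (m := k') (by omega) hN (by omega) (by omega)
        (h₃.trans h₁.symm) (h.trans h₁.symm) with h | h <;> omega
    · by_contra hne
      obtain ⟨k, hk, hkj⟩ := Finset.exists_ne_zero_of_sum_ne_zero hne
      -- The total over a revolution is zero, so an odd count before `q` forces an odd count after
      -- `q`: the ends alternate.
      have tot := hG.sum_edge_eq_zero c (fun e => if e = j then 1 else 0)
      rw [Finset.range_eq_Ico, Finset.sum_eq_sum_Ico_succ_bot (by omega),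
        ← Finset.sum_Ico_consecutive _ (show 0 + 1 ≤ q by omega) hq.le,
        Finset.sum_eq_sum_Ico_succ_bot hq] at tot
      have h₀ : (if G.edge (G.boundaryStep^[0] c) = j then (1 : ZMod 2) else 0) = 0 := if_neg hj
      have hqj : (if G.edge (G.boundaryStep^[q] c) = j then (1 : ZMod 2) else 0) = 0 :=
        if_neg (by rwa [hqc])
      rw [h₀, hqj, zero_add, zero_add, zero_add] at tot
      have hne' : ∑ k ∈ Finset.Ico (q + 1) (Function.minimalPeriod G.boundaryStep c),
          (if G.edge (G.boundaryStep^[k] c) = j then (1 : ZMod 2) else 0) ≠ 0 := by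
        intro h
        rw [h, add_zero] at tot
        exact hne tot
      obtain ⟨m, hm, hmj⟩ := Finset.exists_ne_zero_of_sum_ne_zero hne'
      rw [Finset.mem_Ico] at hk hm
      exact hI ((interlaced_iff c j).2 ⟨k, q, m, by omega, by omega, by omega, by omega,
        by simpa using hkj, hqc, by simpa using hmj⟩)

/-- If `f` is constant along the arcs of the vertex boundary and jumps by `x e` at the ends of the
ribbon `e`, then the row of the intersection matrix at `e`, paired with `x`, is the jump of `f`
along the sides of `e`. -/
theorem IsOneVertex.apply_sideArc [Fintype E] (hG : G.IsOneVertex)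
    {f : C → ZMod 2} {x : E → ZMod 2} (hv : ∀ c, f (G.vertexArc c) = f c)
    (ha : ∀ c, f (G.endArc c) = f c + x (G.edge c)) (c : C) :
    f (G.sideArc c) = f c + ∑ j, G.intersectionMatrix (G.edge c) j * x j := by
  classical
  obtain ⟨q, hq₀, hq, hqc, hside⟩ := hG.exists_other_end c
  have hbetween : ∑ k ∈ Finset.Ico 1 q, x (G.edge (G.boundaryStep^[k] c)) =
      ∑ j, (if G.edge c = j then 0 else G.intersectionMatrix (G.edge c) j) * x j := by
    simp_rw [← hG.sum_between_ite hq₀ hq hqc, Finset.sum_mul]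
    rw [Finset.sum_comm]
    simp
  have hrow : ∑ j, G.intersectionMatrix (G.edge c) j * x j =
      G.intersectionMatrix (G.edge c) (G.edge c) * x (G.edge c) +
        ∑ k ∈ Finset.Ico 1 q, x (G.edge (G.boundaryStep^[k] c)) := by
    rw [hbetween, ← Finset.add_sum_erase _ _ (Finset.mem_univ (G.edge c)),
      ← Finset.add_sum_erase (a := G.edge c) Finset.univ
        (fun j => (if G.edge c = j then 0 else G.intersectionMatrix (G.edge c) j) * x j)
        (Finset.mem_univ _)]
    simp only [if_true, zero_mul, zero_add]
    congr 1
    refine Finset.sum_congr rfl fun j hj => ?_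
    rw [if_neg (Finset.ne_of_mem_erase hj).symm]
  have hjump := G.iterate_boundaryStep_apply_eq_sum hv ha c q
  rw [Finset.range_eq_Ico, Finset.sum_eq_sum_Ico_succ_bot hq₀] at hjump
  rw [hrow]
  -- The path to a first-met corner (twisted) crosses an end of the ribbon itself once; to a
  -- last-met corner (untwisted) twice, which cancels mod 2.
  rcases hside with h | h
  · have hT : G.intersectionMatrix (G.edge c) (G.edge c) = 1 := by
      simp [intersectionMatrix, (twisted_iff c).2 ⟨q, h⟩]
    rw [h, hT, one_mul, hjump]
    simp
  · have hT : G.intersectionMatrix (G.edge c) (G.edge c) = 0 := by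
      simp only [intersectionMatrix, Matrix.of_apply, if_true]
      refine if_neg fun hT => ?_
      obtain ⟨k, hk⟩ := (twisted_iff c).1 hT
      exact G.iterate_boundaryStep_ne_endArc_iterate k q c (hk.symm.trans h)
    rw [h, hT, ha, hqc, hjump, Function.iterate_zero, id, zero_add, zero_mul, zero_add]
    linear_combination CharTwo.add_self_eq_zero (x (G.edge c))

/-- Any prescribed jumps at the ribbons are realised by a function that is constant along the arcs
of the vertex boundary. -/
theorem IsOneVertex.exists_jump (hG : G.IsOneVertex) (x : E → ZMod 2) :
    ∃ f : C → ZMod 2, (∀ c, f (G.vertexArc c) = f c) ∧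
      ∀ c, f (G.endArc c) = f c + x (G.edge c) := by
  classical
  rcases isEmpty_or_nonempty C with _ | ⟨⟨c⟩⟩
  · exact ⟨0, fun c => isEmptyElim c, fun c => isEmptyElim c⟩
  set N := Function.minimalPeriod G.boundaryStep c
  set F : ℕ → ZMod 2 := fun k => ∑ l ∈ Finset.range k, x (G.edge (G.boundaryStep^[l] c)) with hF
  have F_add : ∀ k, F (k + N) = F k := fun k => by
    simp only [hF]
    rw [add_comm, Finset.sum_range_add, hG.sum_edge_eq_zero, zero_add]
    refine Finset.sum_congr rfl fun l _ => ?_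
    rw [add_comm, Function.iterate_add_apply, Function.iterate_minimalPeriod]
  have F_mod : ∀ k, F (k % N) = F k := fun k => Function.Periodic.map_mod_nat F_add k
  have F_eq : ∀ k l, G.boundaryStep^[k] c = G.boundaryStep^[l] c → F k = F l := fun k l h => by
    rw [← F_mod k, ← F_mod l]
    congr 1
    refine G.iterate_boundaryStep_inj (Nat.mod_lt _ (G.minimalPeriod_boundaryStep_pos c))
      (Nat.mod_lt _ (G.minimalPeriod_boundaryStep_pos c)) ?_
    simpa only [N, Function.iterate_mod_minimalPeriod_eq] using h
  have F_succ : ∀ k, F (k + 1) = F k + x (G.edge (G.boundaryStep^[k] c)) := fun k =>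
    Finset.sum_range_succ _ _
  choose κ hκ using hG.exists_iterate c
  -- First-met corners carry the partial sum before the crossing, last-met ones the sum after it.
  set f : C → ZMod 2 := fun d => if d = G.boundaryStep^[κ d] c then F (κ d) else F (κ d + 1)
    with hf
  have f_iter : ∀ k, f (G.boundaryStep^[k] c) = F k := fun k => by
    have h := (hκ (G.boundaryStep^[k] c)).resolve_right
      (G.iterate_boundaryStep_ne_endArc_iterate _ _ _)
    simp only [hf]
    rw [if_pos h]
    exact F_eq _ _ h.symm
  have f_end : ∀ k, f (G.endArc (G.boundaryStep^[k] c)) = F (k + 1) := fun k => by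
    have hne : ¬ G.endArc (G.boundaryStep^[k] c) =
        G.boundaryStep^[κ (G.endArc (G.boundaryStep^[k] c))] c :=
      fun h => G.iterate_boundaryStep_ne_endArc_iterate _ _ _ h.symm
    have h := (hκ (G.endArc (G.boundaryStep^[k] c))).resolve_left hne
    simp only [hf]
    rw [if_neg hne]
    apply F_eq
    have h' := congrArg G.vertexArc h
    rw [Function.iterate_succ_apply', Function.iterate_succ_apply']
    exact h'.symm
  have f_vertex : ∀ k, f (G.vertexArc (G.endArc (G.boundaryStep^[k] c))) =
      f (G.endArc (G.boundaryStep^[k] c)) := fun k => by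
    rw [f_end, ← f_iter (k + 1), Function.iterate_succ_apply']
    rfl
  refine ⟨f, fun d => ?_, fun d => ?_⟩
  · obtain ⟨k, rfl | rfl⟩ := hG.exists_iterate c d
    · obtain ⟨l, hl⟩ := hG.exists_iterate c (G.vertexArc (G.boundaryStep^[k] c))
      rcases hl with hl | hl
      -- A vertex arc cannot join two first-met corners: stepping back would put an `endArc` partner
      -- on the same orbit.
      · exfalso
        have h := congrArg G.endArc (congrArg G.vertexArc hl)
        rw [G.vertexArc_vertexArc] at h
        obtain ⟨m, hm⟩ := G.exists_iterate_boundaryStep_symm 1 (G.endArc (G.vertexArc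
          (G.boundaryStep^[l] c)))
        have e : G.boundaryStep^[1] (G.endArc (G.vertexArc (G.boundaryStep^[l] c))) =
            G.boundaryStep^[l] c := by
          simp [boundaryStep, G.endArc_endArc, G.vertexArc_vertexArc]
        rw [e, ← h, ← Function.iterate_add_apply] at hm
        exact G.iterate_boundaryStep_ne_endArc_iterate _ _ _ hm
      · have h := f_vertex l
        rw [← hl, G.vertexArc_vertexArc] at h
        exact h.symm
    · exact f_vertex k
  · obtain ⟨k, rfl | rfl⟩ := hG.exists_iterate c d
    · rw [f_end, f_iter, F_succ]
    · rw [G.endArc_endArc, f_end, f_iter, G.edge_endArc, F_succ, add_assoc,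
        CharTwo.add_self_eq_zero, add_zero]

end Finite

/-! ### Principal minors, and the proof of the proposition -/

/-- Non-zero determinant means trivial kernel; vectors on `J` are extended by zero so that they can
serve as jumps on all ribbons. -/
theorem det_submatrix_ne_zero_iff [Fintype E] [DecidableEq E] (A : Matrix E E (ZMod 2))
    (J : Finset E) :
    (A.submatrix (Subtype.val : J → E) (Subtype.val : J → E)).det ≠ 0 ↔
      ∀ x : E → ZMod 2, (∀ e ∉ J, x e = 0) → (∀ i ∈ J, ∑ j, A i j * x j = 0) → x = 0 := by
  have hsum : ∀ x : E → ZMod 2, (∀ e ∉ J, x e = 0) → ∀ i,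
      ∑ j, A i j * x j = ∑ j : J, A i j * x j := fun x hx i => by
    rw [Finset.sum_coe_sort J (fun j => A i j * x j)]
    refine (Finset.sum_subset (Finset.subset_univ J) fun j _ hj => ?_).symm
    rw [hx j hj, mul_zero]
  rw [Ne, ← Matrix.exists_mulVec_eq_zero_iff]
  push Not
  constructor
  · intro h x hx hA
    have hxJ : (fun j : J => x j) = 0 := by
      by_contra hne
      refine h _ hne (funext fun i => ?_)
      have := hA i i.2
      rwa [hsum x hx] at this
    funext e
    by_cases he : e ∈ J
    · exact congrFun hxJ ⟨e, he⟩
    · exact hx e he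
  · intro h y hy hA
    apply hy
    set x : E → ZMod 2 := fun e => if he : e ∈ J then y ⟨e, he⟩ else 0 with hx
    have hx0 : ∀ e ∉ J, x e = 0 := fun e he => by simp [hx, he]
    have hxJ : ∀ j : J, x j = y j := fun j => by simp [hx]
    have := h x hx0 fun i hi => by
      rw [hsum x hx0]
      simp_rw [hxJ]
      exact congrFun hA ⟨i, hi⟩
    funext j
    rw [← hxJ, this]
    rfl

end RibbonGraph

open RibbonGraph in
theorem propositionp {E C : Type*} [Fintype E] [DecidableEq E] (G : RibbonGraph E C)
    (hG : G.IsOneVertex) (J : Finset E) :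
    (G.partialDual J).IsOneVertex ↔
      (G.intersectionMatrix.submatrix (Subtype.val : J → E) (Subtype.val : J → E)).det ≠ 0 := by
  have := G.finite_corners
  rw [det_submatrix_ne_zero_iff]
  -- The test-function criterion needs a corner, so the case without ribbons is separate.
  rcases isEmpty_or_nonempty E with hE | ⟨⟨e₀⟩⟩
  · have hJ : J = ∅ := Finset.eq_empty_of_isEmpty J
    rw [hJ, G.partialDual_empty]
    exact ⟨fun _ x _ _ => Subsingleton.elim _ _, fun _ => hG⟩
  obtain ⟨c₀, -⟩ := G.exists_corner e₀
  rw [(G.partialDual J).isOneVertex_iff c₀]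
  constructor
  · rintro ⟨-, h⟩ x hx hM
    obtain ⟨f, hv, ha⟩ := hG.exists_jump x
    have hconst := h f (fun c => ?_) hv
    · funext e
      obtain ⟨c, rfl⟩ := G.exists_corner e
      have := ha c
      rw [hconst (G.endArc c) c] at this
      exact left_eq_add.1 this
    · by_cases hc : G.edge c ∈ J
      · simp only [partialDual, if_pos hc]
        rw [hG.apply_sideArc hv ha, hM _ hc, add_zero]
      · simp only [partialDual, if_neg hc]
        rw [ha, hx _ hc, add_zero]
  · intro h
    refine ⟨((G.isOneVertex_iff c₀).1 hG).1, fun f ha hv => ?_⟩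
    have hs : ∀ c, G.edge c ∈ J → f (G.sideArc c) = f c := fun c hc => by
      simpa [partialDual, hc] using ha c
    have hend : ∀ c, G.edge c ∉ J → f (G.endArc c) = f c := fun c hc => by
      simpa [partialDual, hc] using ha c
    choose r hr using G.exists_corner
    set x : E → ZMod 2 := fun e => f (r e) + f (G.endArc (r e)) with hx
    have hjump : ∀ c, f (G.endArc c) = f c + x (G.edge c) := fun c => by
      -- The jump is the same at both ends of a ribbon: for ribbons in `J`, `f` agrees along each
      -- side; for the others both jumps vanish.
      have key : x (G.edge c) = f c + f (G.endArc c) := by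
        simp only [hx]
        by_cases hc : G.edge c ∈ J
        · rcases G.corner_eq c (r (G.edge c)) (hr _) with e | e | e | e <;> rw [e]
          · rw [G.endArc_endArc, add_comm]
          · rw [G.endArc_sideArc, hs c hc, hs _ (by rwa [G.edge_endArc])]
          · rw [G.endArc_endArc, G.endArc_sideArc, hs c hc, hs _ (by rwa [G.edge_endArc]),
              add_comm]
        · rw [hend _ hc, hend _ (by rwa [hr]), CharTwo.add_self_eq_zero,
            CharTwo.add_self_eq_zero]
      rw [key, ← add_assoc, CharTwo.add_self_eq_zero, zero_add]
    have hx0 : x = 0 := by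
      refine h x (fun e he => ?_) (fun e he => ?_)
      · simp only [hx]
        rw [hend _ (by rwa [hr]), CharTwo.add_self_eq_zero]
      · have := hG.apply_sideArc hv hjump (r e)
        rw [hs _ (by rwa [hr]), hr] at this
        exact left_eq_add.1 this
    exact ((G.isOneVertex_iff c₀).1 hG).2 f (fun c => by rw [hjump, hx0]; exact add_zero _) hv
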